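/- Let $L$ be a nonzero finite-dimensional Lie algebra over a field $F$ of characteristic zero. For a subalgebra $B$ of $L$, let $B_L$ (the core of $B$) be the largest ideal of $L$ contained in $B$; $B$ is called a c-ideal of $L$ if there is an ideal $C$ of $L$ such that $L = B + C$ and $B \cap C \subseteq B_L$. Then $L$ has a solvable maximal subalgebra that is a c-ideal of $L$ if and only if $L$ is solvable. (A maximal subalgebra is a proper subalgebra that is not properly contained in any other proper subalgebra.) -/

import Mathlib

/-- The core `B_L` of a subalgebra `B` of a Lie algebra `L`: the largest ideal of `L` contained in
`B`, built as the supremum of all ideals of `L` contained in `B`. -/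
def LieSubalgebra.core {F L : Type*} [CommRing F] [LieRing L] [LieAlgebra F L]
    (B : LieSubalgebra F L) : LieIdeal F L :=
  sSup {I : LieIdeal F L | I.toSubmodule ≤ B.toSubmodule}

/-- The core of `B` is indeed the largest ideal of `L` contained in `B`. -/
theorem LieSubalgebra.isGreatest_core {F L : Type*} [CommRing F] [LieRing L] [LieAlgebra F L]
    (B : LieSubalgebra F L) :
    IsGreatest {I : LieIdeal F L | I.toSubmodule ≤ B.toSubmodule} B.core := by
  refine ⟨?_, fun I hI => le_sSup hI⟩
  change (sSup {I : LieIdeal F L | I.toSubmodule ≤ B.toSubmodule}).toSubmodule ≤ B.toSubmodule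
  rw [LieSubmodule.sSup_toSubmodule]
  refine sSup_le ?_
  rintro _ ⟨I, hI, rfl⟩
  exact hI

/-- A subalgebra `B` of `L` is a c-ideal of `L` if there is an ideal `C` of `L` such that
`L = B + C` and `B ∩ C ≤ B_L`. Sums and intersections are those of linear subspaces. -/
def LieSubalgebra.IsCIdeal {F L : Type*} [CommRing F] [LieRing L] [LieAlgebra F L]
    (B : LieSubalgebra F L) : Prop :=
  ∃ C : LieIdeal F L, B.toSubmodule ⊔ C.toSubmodule = ⊤ ∧
    B.toSubmodule ⊓ C.toSubmodule ≤ B.core.toSubmodule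

/-! Let `R` be the radical and `M` a solvable maximal c-ideal with witness `C`. If `R` is not inside
`M`, then `L = M + R`, so `L/R` is an image of `M`. Otherwise `L/C` is an image of `M`, and the
semisimple `L/R` has no nonzero solvable quotient, so `C + R = L` (`sup_radical_eq_top`). As `M ∩ C`
lies in the solvable core, hence in `R`, modularity gives `M = R`, and maximality makes `L/R`
abelian. Conversely, any hyperplane containing the derived algebra works. -/

namespace LieIdeal

variable {R L : Type*} [CommRing R] [LieRing L] [LieAlgebra R L]

/-- The quotient map by a Lie ideal, as a morphism of Lie algebras. -/
def quotientHom (I : LieIdeal R L) : L →ₗ⁅R⁆ L ⧸ I :=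
  { I.toSubmodule.mkQ with map_lie' := fun {_ _} => rfl }

theorem quotientHom_surjective (I : LieIdeal R L) : Function.Surjective I.quotientHom :=
  I.toSubmodule.mkQ_surjective

theorem quotientHom_eq_zero_iff {I : LieIdeal R L} {x : L} : I.quotientHom x = 0 ↔ x ∈ I :=
  Submodule.Quotient.mk_eq_zero I.toSubmodule

theorem ker_quotientHom (I : LieIdeal R L) : I.quotientHom.ker = I := by
  ext x
  rw [LieHom.mem_ker, quotientHom_eq_zero_iff]

variable {L' : Type*} [LieRing L'] [LieAlgebra R L'] (f : L →ₗ⁅R⁆ L')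

theorem derivedSeriesOfIdeal_comap_le (J : LieIdeal R L') (k : ℕ) :
    LieAlgebra.derivedSeriesOfIdeal R L k (J.comap f) ≤
      (LieAlgebra.derivedSeriesOfIdeal R L' k J).comap f := by
  induction k with
  | zero => exact le_rfl
  | succ k ih =>
    rw [LieAlgebra.derivedSeriesOfIdeal_succ, LieAlgebra.derivedSeriesOfIdeal_succ]
    exact (LieSubmodule.mono_lie ih ih).trans (LieIdeal.comap_bracket_le (f := f))

/-- The preimage of a solvable ideal under a morphism with solvable kernel is solvable. -/
theorem isSolvable_comap (J : LieIdeal R L') [LieAlgebra.IsSolvable J]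
    [LieAlgebra.IsSolvable f.ker] : LieAlgebra.IsSolvable (J.comap f) := by
  obtain ⟨k, hk⟩ := LieAlgebra.IsSolvable.solvable R J
  obtain ⟨l, hl⟩ := LieAlgebra.IsSolvable.solvable R f.ker
  rw [LieIdeal.derivedSeries_eq_bot_iff] at hk hl
  -- The first `k` derivations push the preimage into the kernel; `l` more kill it.
  refine LieAlgebra.IsSolvable.mk (R := R) (k := l + k) ?_
  rw [LieIdeal.derivedSeries_eq_bot_iff, LieAlgebra.derivedSeriesOfIdeal_add, eq_bot_iff, ← hl]
  refine LieAlgebra.derivedSeriesOfIdeal_mono ?_ l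
  refine (derivedSeriesOfIdeal_comap_le f J k).trans ?_
  rw [hk]
  intro x hx
  simpa using hx

end LieIdeal

namespace LieAlgebra

variable {R L : Type*} [CommRing R] [LieRing L] [LieAlgebra R L]

theorem isSolvable_of_isSolvable_top (h : IsSolvable (⊤ : LieIdeal R L)) : IsSolvable L :=
  (solvable_iff_equiv_solvable (LieIdeal.topEquiv (R := R) (L := L))).mp h

/-- An extension of a solvable Lie algebra by a solvable ideal is solvable. -/
theorem isSolvable_of_quotient (I : LieIdeal R L) [IsSolvable I] [IsSolvable (L ⧸ I)] :
    IsSolvable L := by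
  have : IsSolvable I.quotientHom.ker := by rwa [I.ker_quotientHom]
  have h := LieIdeal.isSolvable_comap I.quotientHom ⊤
  refine isSolvable_of_isSolvable_top (R := R) ?_
  have ht : (⊤ : LieIdeal R (L ⧸ I)).comap I.quotientHom = ⊤ :=
    eq_top_iff.mpr fun x _ => LieIdeal.mem_comap.mpr (LieSubmodule.mem_top _)
  rwa [ht] at h

/-- If `L = B + ker f` with `B` solvable and `f` surjective, then the codomain is solvable. -/
theorem isSolvable_of_surjective_of_sup_ker {L' : Type*} [LieRing L'] [LieAlgebra R L']
    {f : L →ₗ⁅R⁆ L'} (hf : Function.Surjective f) (B : LieSubalgebra R L) [IsSolvable B]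
    {N : Submodule R L} (hN : ∀ x ∈ N, f x = 0) (h : B.toSubmodule ⊔ N = ⊤) : IsSolvable L' := by
  refine Function.Surjective.lieAlgebra_isSolvable (f := f.comp B.incl) fun y => ?_
  obtain ⟨x, rfl⟩ := hf y
  obtain ⟨b, hb, n, hn, rfl⟩ := Submodule.mem_sup.mp (h ▸ Submodule.mem_top : x ∈ B.toSubmodule ⊔ N)
  exact ⟨⟨b, hb⟩, by simp [hN n hn]⟩

/-- The quotient of a Lie algebra by its radical has trivial radical. -/
theorem hasTrivialRadical_quotient_radical [IsNoetherian R L] :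
    HasTrivialRadical R (L ⧸ radical R L) := by
  refine hasTrivialRadical_of_no_solvable_ideals fun J hJ => ?_
  have : IsSolvable (radical R L).quotientHom.ker := by
    rw [LieIdeal.ker_quotientHom]
    infer_instance
  have h := LieIdeal.isSolvable_comap (radical R L).quotientHom J
  rw [LieIdeal.solvable_iff_le_radical] at h
  rw [eq_bot_iff]
  intro y hy
  obtain ⟨x, rfl⟩ := (radical R L).quotientHom_surjective y
  simpa using LieIdeal.quotientHom_eq_zero_iff.mpr (h (LieIdeal.mem_comap.mpr hy))

variable {F : Type*} [Field F] [LieAlgebra F L] [Module.Finite F L]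

/-- An ideal with solvable quotient in a Lie algebra with nondegenerate Killing form is the whole
algebra. -/
theorem eq_top_of_isSolvable_quotient [IsKilling F L] (I : LieIdeal F L) [IsSolvable (L ⧸ I)] :
    I = ⊤ := by
  have hc := I.isCompl_killingCompl
  -- The Killing complement meets `I` trivially, so it embeds in `L ⧸ I`.
  have hs : IsSolvable I.killingCompl := by
    refine Function.Injective.lieAlgebra_isSolvable (R := F)
      (f := I.quotientHom.comp I.killingCompl.incl) ?_
    refine (injective_iff_map_eq_zero _).mpr fun x hx => ?_
    have hxI : (x : L) ∈ I := LieIdeal.quotientHom_eq_zero_iff.mp hx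
    have := (LieSubmodule.mem_inf _ _ _).mpr ⟨hxI, x.2⟩
    rw [hc.inf_eq_bot] at this
    exact Subtype.ext (by simpa using this)
  have hb := HasTrivialRadical.eq_bot_of_isSolvable (LieIdeal.killingCompl F L I)
  simpa [hb] using hc.sup_eq_top

/-- In characteristic zero, an ideal with a solvable supplementary subalgebra is supplementary to
the radical. -/
theorem sup_radical_eq_top [CharZero F] (B : LieSubalgebra F L) [IsSolvable B] (C : LieIdeal F L)
    (h : B.toSubmodule ⊔ C.toSubmodule = ⊤) : C ⊔ radical F L = ⊤ := by
  have := hasTrivialRadical_quotient_radical (R := F) (L := L)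
  have : Module.Finite F (L ⧸ radical F L) :=
    Module.Finite.of_surjective ((radical F L).quotientHom : L →ₗ[F] L ⧸ radical F L)
      (radical F L).quotientHom_surjective
  set q := (radical F L).quotientHom with hq
  have hqs : Function.Surjective q := (radical F L).quotientHom_surjective
  have : IsSolvable ((L ⧸ radical F L) ⧸ C.map q) := by
    refine isSolvable_of_surjective_of_sup_ker (f := (C.map q).quotientHom.comp q)
      ((C.map q).quotientHom_surjective.comp hqs) B (N := C.toSubmodule) (fun x hx => ?_) h
    exact LieIdeal.quotientHom_eq_zero_iff.mpr (LieIdeal.mem_map hx)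
  -- Characteristic zero enters here: Cartan's criterion makes the Killing form of `L ⧸ radical F L`
  -- nondegenerate.
  have ht := eq_top_of_isSolvable_quotient (C.map q)
  have := LieIdeal.comap_map_eq (f := q) (I := C) 
    (SetLike.ext'_iff.mp (LieIdeal.coe_map_of_surjective hqs))
  rw [ht, hq, LieIdeal.ker_quotientHom] at this
  rw [← this, eq_top_iff]
  intro x _
  simp

end LieAlgebra

namespace LieSubalgebra

variable {F L : Type*} [Field F] [LieRing L] [LieAlgebra F L]

/-- A maximal subalgebra supplements every ideal it does not contain. -/
theorem sup_toSubmodule_eq_top {M : LieSubalgebra F L} (hM : IsCoatom M) {I : LieIdeal F L}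
    (hI : ¬ I.toSubmodule ≤ M.toSubmodule) : M.toSubmodule ⊔ I.toSubmodule = ⊤ := by
  let S : LieSubalgebra F L :=
    { M.toSubmodule ⊔ I.toSubmodule with
      lie_mem' := by
        intro x y hx hy
        obtain ⟨a, ha, i, hi, rfl⟩ := Submodule.mem_sup.mp hx
        obtain ⟨b, hb, j, hj, rfl⟩ := Submodule.mem_sup.mp hy
        refine Submodule.mem_sup.mpr ⟨⁅a, b⁆, M.lie_mem ha hb, ⁅a, j⁆ + ⁅i, b + j⁆,
          add_mem (lie_mem_right F L I a j hj) (lie_mem_left F L I i (b + j) hi), ?_⟩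
        simp only [lie_add, add_lie]
        abel }
  have hS : S = ⊤ := by
    refine hM.2 S (lt_of_le_of_ne (fun x hx => Submodule.mem_sup_left hx) ?_)
    rintro hMS
    exact hI fun x hx => hMS ▸ (Submodule.mem_sup_right hx : x ∈ M.toSubmodule ⊔ I.toSubmodule)
  rw [eq_top_iff]
  intro x _
  exact (hS ▸ LieSubalgebra.mem_top x : x ∈ S)

/-- A Lie algebra in which a solvable ideal is a maximal subalgebra is solvable. -/
theorem isSolvable_of_isCoatom_of_ideal {M : LieSubalgebra F L} (hM : IsCoatom M)
    (I : LieIdeal F L) [LieAlgebra.IsSolvable I] (hI : M.toSubmodule = I.toSubmodule) :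
    LieAlgebra.IsSolvable L := by
  have hmem : ∀ x, x ∈ M ↔ x ∈ I := fun x => (SetLike.ext_iff.mp hI x :)
  obtain ⟨z, hz⟩ : ∃ z, z ∉ M := by
    by_contra! h
    exact hM.1 (eq_top_iff.mpr fun x _ => h x)
  -- The only term not involving `I` is a multiple of `⁅z, z⁆ = 0`. So `I + Fz` is a subalgebra, all
  -- of `L` by maximality, and `L ⧸ I` is abelian.
  have hlie : ∀ (m n : L) (a b : F), m ∈ I → n ∈ I → ⁅m + a • z, n + b • z⁆ ∈ I := by
    intro m n a b hm hn
    have : ⁅m + a • z, n + b • z⁆ = ⁅m, n + b • z⁆ + a • ⁅z, n⁆ := by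
      simp [add_right_comm]
    rw [this]
    exact add_mem (lie_mem_left F L I m _ hm) (I.smul_mem a (lie_mem_right F L I z n hn))
  let S : LieSubalgebra F L :=
    { I.toSubmodule ⊔ Submodule.span F {z} with
      lie_mem' := by
        intro x y hx hy
        obtain ⟨m, hm, u, hu, rfl⟩ := Submodule.mem_sup.mp hx
        obtain ⟨n, hn, v, hv, rfl⟩ := Submodule.mem_sup.mp hy
        obtain ⟨a, rfl⟩ := Submodule.mem_span_singleton.mp hu
        obtain ⟨b, rfl⟩ := Submodule.mem_span_singleton.mp hv
        exact Submodule.mem_sup_left (hlie m n a b hm hn) }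
  have hS : S = ⊤ := by
    refine hM.2 S (lt_of_le_of_ne (fun x hx => Submodule.mem_sup_left ((hmem x).mp hx)) ?_)
    rintro hMS
    exact hz (hMS ▸ (Submodule.mem_sup_right (Submodule.mem_span_singleton_self z) :
      z ∈ I.toSubmodule ⊔ Submodule.span F {z}))
  have hdec : ∀ x : L, ∃ m ∈ I, ∃ a : F, x = m + a • z := by
    intro x
    have hx : x ∈ I.toSubmodule ⊔ Submodule.span F {z} := (hS ▸ LieSubalgebra.mem_top x : x ∈ S)
    obtain ⟨m, hm, u, hu, rfl⟩ := Submodule.mem_sup.mp hx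
    obtain ⟨a, rfl⟩ := Submodule.mem_span_singleton.mp hu
    exact ⟨m, hm, a, rfl⟩
  have : IsLieAbelian (L ⧸ I) := by
    refine ⟨fun x y => ?_⟩
    obtain ⟨x, rfl⟩ := I.quotientHom_surjective x
    obtain ⟨y, rfl⟩ := I.quotientHom_surjective y
    obtain ⟨m, hm, a, rfl⟩ := hdec x
    obtain ⟨n, hn, b, rfl⟩ := hdec y
    rw [← LieHom.map_lie, LieIdeal.quotientHom_eq_zero_iff]
    exact hlie m n a b hm hn
  exact LieAlgebra.isSolvable_of_quotient I

theorem toSubmodule_le_core {B : LieSubalgebra F L} {I : LieIdeal F L}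
    (h : I.toSubmodule ≤ B.toSubmodule) : I ≤ B.core :=
  B.isGreatest_core.2 h

theorem core_le {B : LieSubalgebra F L} : B.core.toSubmodule ≤ B.toSubmodule :=
  B.isGreatest_core.1

instance isSolvable_core (B : LieSubalgebra F L) [LieAlgebra.IsSolvable B] :
    LieAlgebra.IsSolvable B.core :=
  Function.Injective.lieAlgebra_isSolvable (R := F) (L := B)
    (f := LieSubalgebra.inclusion (K := B.core.toLieSubalgebra F L) (K' := B) fun _ hx => core_le hx)
    (LieSubalgebra.inclusion_injective _)

/-- In characteristic zero, a Lie algebra with a solvable maximal subalgebra that is a c-ideal is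
solvable. -/
theorem IsCIdeal.isSolvable [CharZero F] [Module.Finite F L] {M : LieSubalgebra F L}
    (h : M.IsCIdeal) (hM : IsCoatom M) [LieAlgebra.IsSolvable M] : LieAlgebra.IsSolvable L := by
  by_cases hR : (LieAlgebra.radical F L).toSubmodule ≤ M.toSubmodule
  · obtain ⟨C, hC, hMC⟩ := h
    have hcore : M.core ≤ LieAlgebra.radical F L :=
      (LieAlgebra.LieIdeal.solvable_iff_le_radical F L _).mp inferInstance
    have htop := LieAlgebra.sup_radical_eq_top M C hC
    refine isSolvable_of_isCoatom_of_ideal hM (LieAlgebra.radical F L) (le_antisymm ?_ hR)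
    intro x hx
    obtain ⟨c, hc, r, hr, rfl⟩ := (LieSubmodule.mem_sup _ _ _).mp
      (htop ▸ LieSubmodule.mem_top x : x ∈ C ⊔ LieAlgebra.radical F L)
    have hcM : c ∈ M.toSubmodule := by simpa using sub_mem hx (hR hr)
    exact add_mem (hcore (hMC ⟨hcM, hc⟩)) hr
  · have := LieAlgebra.isSolvable_of_surjective_of_sup_ker
      (LieAlgebra.radical F L).quotientHom_surjective M
      (fun x hx => LieIdeal.quotientHom_eq_zero_iff.mpr hx) (sup_toSubmodule_eq_top hM hR)
    exact LieAlgebra.isSolvable_of_quotient (LieAlgebra.radical F L)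

/-- An ideal is a c-ideal. -/
theorem isCIdeal_of_ideal (I : LieIdeal F L) : (I.toLieSubalgebra F L).IsCIdeal :=
  ⟨⊤, by simp, fun _ hx => toSubmodule_le_core (le_refl I.toSubmodule) hx.1⟩

/-- A nonzero solvable Lie algebra has an ideal of codimension one, hence a maximal subalgebra that
is an ideal. -/
theorem exists_ideal_isCoatom [Nontrivial L] [LieAlgebra.IsSolvable L] :
    ∃ I : LieIdeal F L, IsCoatom (I.toLieSubalgebra F L) := by
  have hD : (LieAlgebra.derivedSeries F L 1).toSubmodule ≠ ⊤ := fun h =>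
    (LieAlgebra.derivedSeries_lt_top_of_solvable (R := F) (L := L)).ne
      (LieSubmodule.toSubmodule_injective h)
  obtain ⟨H, hH, hDH⟩ := (eq_top_or_exists_le_coatom
    (LieAlgebra.derivedSeries F L 1).toSubmodule).resolve_left hD
  have hlie : ∀ x y : L, ⁅x, y⁆ ∈ H := fun x y => hDH (by
    rw [LieSubmodule.mem_toSubmodule, LieAlgebra.derivedSeries_def,
      LieAlgebra.derivedSeriesOfIdeal_succ]
    exact LieSubmodule.lie_mem_lie (LieSubmodule.mem_top x) (LieSubmodule.mem_top y))
  -- Maximality among subspaces is stronger than maximality among subalgebras.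
  refine ⟨{ H with lie_mem := fun {x y} _ => hlie x y }, fun h => hH.1 ?_, fun S hS => ?_⟩
  · rw [eq_top_iff]
    exact fun x _ => (h ▸ LieSubalgebra.mem_top x :)
  · have : S.toSubmodule = ⊤ := hH.2 _ hS
    rwa [LieSubalgebra.toSubmodule_eq_top] at this

end LieSubalgebra

theorem theoremt {F L : Type*} [Field F] [CharZero F] [LieRing L] [LieAlgebra F L]
    [Module.Finite F L] [Nontrivial L] :
    (∃ M : LieSubalgebra F L, IsCoatom M ∧ LieAlgebra.IsSolvable M ∧ M.IsCIdeal) ↔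
      LieAlgebra.IsSolvable L := by
  constructor
  · rintro ⟨M, hM, hs, hc⟩
    exact hc.isSolvable hM
  · intro h
    obtain ⟨I, hI⟩ := LieSubalgebra.exists_ideal_isCoatom (F := F) (L := L)
    exact ⟨_, hI, I.incl_injective.lieAlgebra_isSolvable (R := F),
      LieSubalgebra.isCIdeal_of_ideal I⟩
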